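/- **Conventions.** The functional graph of a map $f:S\to S$ on a finite set is the digraph with vertex set $S$ and arcs $s\to f(s)$. In rooted trees the arcs point towards the root; $\bullet$ is the one-node tree. $\oplus$ is disjoint union of digraphs, $n\times H$ is the disjoint union of $n$ copies of $H$, and $\langle T_1\oplus\cdots\oplus T_r\rangle$ is the rooted tree obtained by adding a new root whose children are the roots of $T_1,\dots,T_r$ (so $\langle\emptyset\rangle=\bullet$). For $m\ge 1$ and a rooted tree $T$, $\operatorname{Cyc}(m,T)$ is the digraph consisting of a directed cycle of length $m$ in which every node is the root of a copy of $T$. $\varphi$ is Euler's totient function and $\operatorname{ord}_d(t)$ the multiplicative order of $t$ modulo $d$ (with $\operatorname{ord}_1(t)=1$). *Elementary trees.* For a non-increasing sequence $v=(v_1,\dots,v_d)$ of positive integers, $d\ge 1$, put $T_v^0=\bullet$, $$T_v^k=\Big\langle v_k\times T_v^{k-1}\oplus\bigoplus_{i=1}^{k-1}(v_i-v_{i+1})\times T_v^{i-1}\Big\rangle\ (1\le k<d),\qquad \mathcal T_v=\Big\langle (v_d-1)\times T_v^{d-1}\oplus\bigoplus_{i=1}^{d-1}(v_i-v_{i+1})\times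 T_v^{i-1}\Big\rangle .$$ *Iterated gcd.* For positive integers $t,n$, $\gcd_t(n)=(v_1,\dots,v_D)$, where $v_1=\gcd(t,n)$, $v_{i+1}=\gcd\big(t,n/(v_1\cdots v_i)\big)$ for $i\ge1$, and $D$ is the least positive integer with $v_{D+1}=1$ (so $\gcd_t(n)=(1)$ if $\gcd(t,n)=1$). *Flower groups.* A $\mu$-subgroup of a group is a cyclic subgroup that is not contained in any other cyclic subgroup. Let $G$ be a finite noncyclic group and $C_1,\dots,C_k$ its distinct $\mu$-subgroups. $G$ is a flower group of type $(c_0;c_1,\dots,c_k)$ if there is a subgroup $C_0$ of $G$ with $C_i\cap C_j=C_0$ for all $1\le i<j\le k$, and $c_i=|C_i|$ for $0\le i\le k$. *Central tree.* For a positive integer $t$ let $\varphi_t:G\to G$, $\varphi_t(g)=g^t$. The central tree $\mathcal T_t(G)$ is the rooted tree attached to the identity $1$ in the functional graph of $\varphi_t$: its nodes are the $g\in G$ whose forward orbit under $\varphi_t$ has $1$ as its first periodic point, its root is $1$, and its arcs are $g\to g^t$ for the nodes $g\neq 1$. **Theorem.** Let $t$ be a positive integer and let $G$ be a flower group of type $(c_0;c_1,\dots,c_k)$.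 For $0\le i\le k$ write $c_i=\nu_i\omega_i$, where $\omega_i$ is the greatest divisor of $c_i$ that is coprime to $t$. Then the functional graph of $\varphi_t:G\to G$, $g\mapsto g^t$, is isomorphic, as a digraph, to $$\left(\bigoplus_{i=1}^k\ \bigoplus_{\substack{d_i\mid\omega_i\\ d_i\nmid\omega_0}}\frac{\varphi(d_i)}{\operatorname{ord}_{d_i}(t)}\times\operatorname{Cyc}\big(\operatorname{ord}_{d_i}(t),\mathcal T_{\gcd_t(\nu_i)}\big)\right)\oplus\left(\bigoplus_{d_0\mid\omega_0}\frac{\varphi(d_0)}{\operatorname{ord}_{d_0}(t)}\times\operatorname{Cyc}\big(\operatorname{ord}_{d_0}(t),\mathcal T_t(G)\big)\right),$$ and the central tree $\mathcal T_t(G)$ has exactly $\sum_{i=1}^k\nu_i-(k-1)\nu_0$ nodes. -/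

import Mathlib

namespace FlowerGroup

universe u v

/-! ### Directed graphs -/

/-- The functional graph of `f`: one arc `s → f s` for every `s`. -/
def functionalGraph {S : Type u} (f : S → S) : Digraph S where
  Adj s s' := f s = s'

/-- The disjoint union of two digraphs. -/
def disjUnion {V : Type u} {W : Type v} (A : Digraph V) (B : Digraph W) : Digraph (V ⊕ W) where
  Adj := Sum.LiftRel A.Adj B.Adj

/-- Adjacency in the disjoint union of a family of digraphs. -/
inductive SigmaAdj {ι : Type u} {V : ι → Type v} (A : ∀ i, Digraph (V i)) :
    (Σ i, V i) → (Σ i, V i) → Prop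
  | mk (i : ι) (x y : V i) : (A i).Adj x y → SigmaAdj A ⟨i, x⟩ ⟨i, y⟩

/-- The disjoint union of a family of digraphs. -/
def disjUnionFamily {ι : Type u} {V : ι → Type v} (A : ∀ i, Digraph (V i)) :
    Digraph (Σ i, V i) where
  Adj := SigmaAdj A

/-- The disjoint union of `n` copies of a digraph. -/
def copies {V : Type u} (n : ℕ) (A : Digraph V) : Digraph (Fin n × V) where
  Adj x y := x.1 = y.1 ∧ A.Adj x.2 y.2

/-- Isomorphism of digraphs. -/
def Isomorphic {V : Type u} {W : Type v} (A : Digraph V) (B : Digraph W) : Prop :=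
  Nonempty (A.Adj ≃r B.Adj)

/-! ### Rooted trees -/

/-- A rooted tree, with arcs directed towards the root: the root has no outgoing arc, no vertex has
two outgoing arcs, and from every vertex there is a directed path to the root. -/
structure RTree where
  /-- the nodes -/
  V : Type u
  /-- the arcs, from a child to its parent -/
  graph : Digraph V
  /-- the root -/
  root : V
  root_sink : ∀ w, ¬ graph.Adj root w
  out_unique : ∀ x y z, graph.Adj x y → graph.Adj x z → y = z
  reach : ∀ x, Relation.ReflTransGen graph.Adj x root

/-- The rooted tree with a single node. -/
def RTree.bullet : RTree.{0} where
  V := Unit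
  graph := ⟨fun _ _ => False⟩
  root := ()
  root_sink _ h := h
  out_unique _ _ _ _ _ := rfl
  reach _ := Relation.ReflTransGen.refl

/-- Adjacency in `⟨⨁ i, T i⟩`; the new root is `none`. -/
inductive JoinAdj {ι : Type} (T : ι → RTree.{0}) :
    Option (Σ i, (T i).V) → Option (Σ i, (T i).V) → Prop
  | inner (i : ι) (x y : (T i).V) : (T i).graph.Adj x y → JoinAdj T (some ⟨i, x⟩) (some ⟨i, y⟩)
  | top (i : ι) : JoinAdj T (some ⟨i, (T i).root⟩) none

/-- The rooted tree `⟨⨁ i, T i⟩`, obtained from the forest with components `T i` by adding a new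
root whose children are the roots of the `T i`. -/
def RTree.join {ι : Type} (T : ι → RTree.{0}) : RTree.{0} where
  V := Option (Σ i, (T i).V)
  graph := ⟨JoinAdj T⟩
  root := none
  root_sink := by
    intro w h
    cases h
  out_unique := by
    intro x y z h1 h2
    cases h1 with
    | inner i x y h =>
      cases h2 with
      | inner _ _ z h' => rw [(T i).out_unique x y z h h']
      | top _ => exact absurd h ((T i).root_sink y)
    | top i =>
      cases h2 with
      | inner _ _ z h' => exact absurd h' ((T i).root_sink z)
      | top _ => rfl
  reach := by
    rintro (_ | ⟨i, x⟩)
    · exact Relation.ReflTransGen.refl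
    · have h : Relation.ReflTransGen (JoinAdj T) (some ⟨i, x⟩) (some ⟨i, (T i).root⟩) :=
        Relation.ReflTransGen.lift (fun z => some (⟨i, z⟩ : Σ i, (T i).V))
          (fun a b hab => JoinAdj.inner i a b hab) _ _ ((T i).reach x)
      exact h.tail (JoinAdj.top i)

/-- The digraph `Cyc(m, T)` for `m ≥ 1`: a directed `m`-cycle, whose nodes are indexed by `ZMod m`,
in which every node is the root of a copy of the rooted tree `T`. -/
def cyc (m : ℕ) (T : RTree.{u}) : Digraph (ZMod m × T.V) where
  Adj x y := (x.1 = y.1 ∧ T.graph.Adj x.2 y.2) ∨ (x.2 = T.root ∧ y.2 = T.root ∧ y.1 = x.1 + 1)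

/-- The auxiliary trees `T_ν^k` of an elementary tree. The sequence `(ν_1, ν_2, …)` is indexed from
zero: `ν i` stands for `ν_{i+1}`. Thus `T_ν^0 = •` and
`T_ν^{k+1} = ⟨ν_{k+1} × T_ν^k ⊕ ⨁_{i < k} (ν_{i+1} - ν_{i+2}) × T_ν^i⟩`. -/
def elementarySubtree (ν : ℕ → ℕ) : ℕ → RTree.{0}
  | 0 => RTree.bullet
  | k + 1 => RTree.join
      (ι := Fin (ν k) ⊕ (Σ i : Fin k, Fin (ν i - ν (i + 1))))
      (Sum.elim (fun _ => elementarySubtree ν k) (fun p => elementarySubtree ν p.1.1))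
  termination_by k => k
  decreasing_by
    · exact Nat.lt_succ_self k
    · exact Nat.lt_succ_of_lt p.1.2

/-- The elementary tree `T_ν` of a non-increasing sequence `ν = (ν_1, …, ν_d)` of positive integers
with `d ≥ 1` terms; again `ν i` stands for `ν_{i+1}` and only `ν 0, …, ν (d - 1)` are used.
With `d = e + 1`, `T_ν = ⟨(ν_d - 1) × T_ν^{d-1} ⊕ ⨁_{i < d - 1} (ν_{i+1} - ν_{i+2}) × T_ν^i⟩`. -/
def elementaryTree (ν : ℕ → ℕ) : ℕ → RTree.{0}
  | 0 => RTree.bullet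
  | e + 1 => RTree.join
      (ι := Fin (ν e - 1) ⊕ (Σ i : Fin e, Fin (ν i - ν (i + 1))))
      (Sum.elim (fun _ => elementarySubtree ν e) (fun p => elementarySubtree ν p.1.1))

/-! ### The iterated gcd -/

/-- `gcdRem t n i = n / (ν_1 ⋯ ν_i)`, where `ν_{i+1} = gcd(t, n / (ν_1 ⋯ ν_i))`. -/
def gcdRem (t n : ℕ) : ℕ → ℕ
  | 0 => n
  | i + 1 => gcdRem t n i / Nat.gcd t (gcdRem t n i)

/-- The terms of the iterated gcd of `n` relative to `t`, indexed from zero: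
`gcdSeq t n i = ν_{i+1}`. -/
def gcdSeq (t n i : ℕ) : ℕ := Nat.gcd t (gcdRem t n i)

/-- The length `D` of the iterated gcd: the least positive `D` with `ν_{D+1} = 1`
(if `gcd(t, n) = 1` then `D = 1`, and the sequence is `(1)`). -/
noncomputable def gcdLength (t n : ℕ) : ℕ := sInf {D | 0 < D ∧ gcdSeq t n D = 1}

/-- The elementary tree `T_{gcd_t(n)}`. -/
noncomputable def gcdTree (t n : ℕ) : RTree.{0} := elementaryTree (gcdSeq t n) (gcdLength t n)

/-! ### Trees attached to periodic points -/

/-- `y` belongs to the tree attached to the periodic point `x`: the orbit of `y` under `f` reaches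
`x`, and `x` is the first periodic point on it. -/
def InAttachedTree {S : Type u} (f : S → S) (x y : S) : Prop :=
  ∃ n, f^[n] y = x ∧ ∀ m < n, f^[m] y ∉ Function.periodicPts f

/-- The rooted tree attached to the periodic point `x` in the functional graph of `f`. -/
def attachedTree {S : Type u} (f : S → S) (x : S) : RTree.{u} where
  V := {y : S // InAttachedTree f x y}
  graph := ⟨fun y z => y.1 ≠ x ∧ f y.1 = z.1⟩
  root := ⟨x, 0, rfl, fun _ hm => absurd hm (Nat.not_lt_zero _)⟩
  root_sink _ h := h.1 rfl
  out_unique _ _ _ h1 h2 := Subtype.ext (h1.2.symm.trans h2.2)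
  reach := by
    rintro ⟨y, n, hn, hm⟩
    induction n generalizing y with
    | zero =>
      have hy : y = x := hn
      subst hy
      exact Relation.ReflTransGen.refl
    | succ n ih =>
      by_cases hy : y = x
      · subst hy
        exact Relation.ReflTransGen.refl
      · have h1 : f^[n] (f y) = x := by rwa [Function.iterate_succ_apply] at hn
        have h2 : ∀ m < n, f^[m] (f y) ∉ Function.periodicPts f := by
          intro m hmn
          rw [← Function.iterate_succ_apply]
          exact hm (m + 1) (Nat.succ_lt_succ hmn)
        exact Relation.ReflTransGen.head ⟨hy, rfl⟩ (ih (f y) h1 h2)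

/-- The power map `g ↦ g ^ t`. -/
def powerMap (G : Type u) [Group G] (t : ℕ) : G → G := fun g => g ^ t

/-- The central tree `T_t(G)`: the tree attached to the identity in the functional graph of the
power map `g ↦ g ^ t`. -/
def centralTree (t : ℕ) (G : Type u) [Group G] : RTree.{u} := attachedTree (powerMap G t) 1

/-! ### Flower groups -/

/-- A `μ`-subgroup is a maximal cyclic subgroup. -/
def IsMuSubgroup {G : Type u} [Group G] (H : Subgroup G) : Prop :=
  IsCyclic H ∧ ∀ K : Subgroup G, IsCyclic K → H ≤ K → K = H

/-- `G` is a flower group with pistil `C₀` and petals `C 0, …, C (k - 1)`, listed without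
repetition: `G` is finite and noncyclic, the petals are exactly the `μ`-subgroups of `G`, and any
two distinct petals intersect in `C₀`. -/
structure IsFlower {G : Type u} [Group G] {k : ℕ} (C₀ : Subgroup G) (C : Fin k → Subgroup G) :
    Prop where
  finite : Finite G
  not_cyclic : ¬ IsCyclic G
  injective : Function.Injective C
  petal_iff : ∀ H : Subgroup G, IsMuSubgroup H ↔ ∃ i, C i = H
  inter : ∀ i j, i ≠ j → C i ⊓ C j = C₀

/-- `G` is a flower group of type `(c₀; c 0, …, c (k - 1))`. -/
def IsFlowerGroupOfType (G : Type u) [Group G] {k : ℕ} (c₀ : ℕ) (c : Fin k → ℕ) : Prop :=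
  ∃ (C₀ : Subgroup G) (C : Fin k → Subgroup G), IsFlower C₀ C ∧
    Nat.card C₀ = c₀ ∧ ∀ i, Nat.card (C i) = c i

/-- `ω` is the greatest divisor of `c` that is relatively prime with `t`. -/
def IsCoprimePart (t c ω : ℕ) : Prop := IsGreatest {d : ℕ | d ∣ c ∧ Nat.Coprime d t} ω

/-- The multiplicative order `ord_d(t)` of `t` modulo `d`. -/
noncomputable def ordMod (d t : ℕ) : ℕ := orderOf (t : ZMod d)

/-- The digraph `(φ(d) / ord_d(t)) × Cyc(ord_d(t), T)`. -/
noncomputable def cycleBlock (t d : ℕ) (T : RTree.{u}) :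
    Digraph (Fin (Nat.totient d / ordMod d t) × (ZMod (ordMod d t) × T.V)) :=
  copies (Nat.totient d / ordMod d t) (cyc (ordMod d t) T)

end FlowerGroup

/-! Since G is finite, some iterate `g ↦ g ^ t ^ K` of the power map is idempotent. Put w = g ^ t ^
K and x = g w⁻¹. Then g = x w, where w is periodic (its order is coprime to t), x is killed by a
power of t, and both lie in any petal containing g. The splitting is unique
(`eq_of_mul_eq_mul_of_pow`). So G is cut into blocks according to the petal or pistil containing w
and the order d of w.

If w lies outside the pistil, its petal is unique, so x ranges over the tree of 1 in that cyclic
petal. If w lies in the pistil, it is central, so x ranges over the whole central tree. In both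
cases `cycleBlock_realizes` makes the block a union of cycles carrying copies of the tree. In a
cyclic group the tree of 1 is elementary: vertices are sorted by the largest j for which they are
t^j-th powers, and roots of each height are counted by cosets (`elementaryTree_realizes`).

The node count follows because, off the pistil, the petals partition G (`IsFlower.ncard_eq_sum`). -/

namespace FlowerGroup

open Function

universe u v

/-! ### Digraphs realized inside functional graphs -/

/-- Every vertex of `A` has an outgoing arc, and `A` is a copy of the part of the functional graph
of `f` that is carried by `X`. -/
structure Realizes {V : Type u} {S : Type v} (A : Digraph V) (f : S → S) (X : Set S) : Prop where
  total : ∀ x, ∃ y, A.Adj x y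
  exists_map : ∃ F : V → S, Injective F ∧ (∀ x y, A.Adj x y → f (F x) = F y) ∧ Set.range F = X

/-- A functional graph has out-degree one. The arc that leaves x in `A`, which exists by totality,
must therefore map to the only arc available, so arcs are reflected as well as preserved. -/
theorem Realizes.isomorphic {V : Type u} {S : Type v} {A : Digraph V} {f : S → S}
    (h : Realizes A f Set.univ) : Isomorphic (functionalGraph f) A := by
  obtain ⟨htot, F, hF, hadj, hrange⟩ := h
  let e : V ≃ S := Equiv.ofBijective F ⟨hF, Set.range_eq_univ.mp hrange⟩
  refine ⟨RelIso.symm ⟨e, ?_⟩⟩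
  intro x y
  constructor
  · intro hxy
    obtain ⟨z, hz⟩ := htot x
    have : F z = F y := (hadj x z hz).symm.trans hxy
    rwa [← hF this]
  · exact hadj x y

theorem Realizes.disjUnion {V W : Type*} {S : Type*} {A : Digraph V} {B : Digraph W}
    {f : S → S} {X Y : Set S} (hA : Realizes A f X) (hB : Realizes B f Y) (hXY : Disjoint X Y) :
    Realizes (disjUnion A B) f (X ∪ Y) := by
  obtain ⟨htA, F, hF, hFadj, rfl⟩ := hA
  obtain ⟨htB, F', hF', hFadj', rfl⟩ := hB
  refine ⟨?_, Sum.elim F F', ?_, ?_, Set.Sum.elim_range F F'⟩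
  · rintro (x | x)
    · obtain ⟨y, hy⟩ := htA x
      exact ⟨Sum.inl y, Sum.LiftRel.inl hy⟩
    · obtain ⟨y, hy⟩ := htB x
      exact ⟨Sum.inr y, Sum.LiftRel.inr hy⟩
  · refine hF.sumElim hF' fun a b hab => ?_
    exact Set.disjoint_left.mp hXY ⟨a, rfl⟩ ⟨b, hab.symm⟩
  · rintro _ _ (h | h)
    · exact hFadj _ _ h
    · exact hFadj' _ _ h

theorem Realizes.disjUnionFamily {ι : Type*} {V : ι → Type*} {S : Type*}
    {A : ∀ i, Digraph (V i)} {f : S → S} {X : ι → Set S} (hA : ∀ i, Realizes (A i) f (X i))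
    (hX : ∀ i j, i ≠ j → Disjoint (X i) (X j)) :
    Realizes (disjUnionFamily A) f (⋃ i, X i) := by
  choose F hF hadj hrange using fun i => (hA i).exists_map
  refine ⟨?_, fun p => F p.1 p.2, ?_, ?_, ?_⟩
  · rintro ⟨i, x⟩
    obtain ⟨y, hy⟩ := (hA i).total x
    exact ⟨⟨i, y⟩, SigmaAdj.mk i x y hy⟩
  · rintro ⟨i, x⟩ ⟨j, y⟩ (hxy : F i x = F j y)
    by_cases hij : i = j
    · subst hij
      rw [hF i hxy]
    · have hi : F i x ∈ X i := by rw [← hrange i]; exact ⟨x, rfl⟩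
      have hj : F i x ∈ X j := by rw [hxy, ← hrange j]; exact ⟨y, rfl⟩
      exact absurd hj (Set.disjoint_left.mp (hX i j hij) hi)
  · rintro _ _ ⟨i, x, y, h⟩
    exact hadj i x y h
  · ext s
    simp only [Set.mem_range, Sigma.exists, Set.mem_iUnion, ← hrange]

theorem Realizes.copies {n : ℕ} {V S : Type*} {A : Digraph V} {f : S → S} {X : Fin n → Set S}
    (hA : ∀ i, Realizes A f (X i)) (hn : ∀ x, ∃ y, A.Adj x y)
    (hX : ∀ i j, i ≠ j → Disjoint (X i) (X j)) : Realizes (copies n A) f (⋃ i, X i) := by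
  obtain ⟨-, F, hF, hadj, hrange⟩ := Realizes.disjUnionFamily hA hX
  refine ⟨?_, fun p => F ⟨p.1, p.2⟩, ?_, ?_, ?_⟩
  · rintro ⟨i, x⟩
    obtain ⟨y, hy⟩ := hn x
    exact ⟨(i, y), rfl, hy⟩
  · rintro ⟨i, x⟩ ⟨j, y⟩ hxy
    have := hF hxy
    simp only [Sigma.mk.injEq, heq_eq_eq] at this
    exact Prod.ext this.1 this.2
  · rintro ⟨i, x⟩ ⟨j, y⟩ ⟨h1, h2⟩
    dsimp only at h1 h2
    subst h1
    exact hadj _ _ (SigmaAdj.mk (A := fun _ => A) i x y h2)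
  · rw [← hrange]
    ext s
    simp

/-- The rooted tree `T` is a copy of the part of the functional graph of `f` that is carried by `X`,
up to the arc leaving the image `r` of the root. -/
def RTree.Realizes {S : Type v} (T : RTree.{u}) (f : S → S) (r : S) (X : Set S) : Prop :=
  ∃ F : T.V → S, Injective F ∧ F T.root = r ∧ (∀ x y, T.graph.Adj x y → f (F x) = F y) ∧
    Set.range F = X

theorem RTree.exists_adj (T : RTree.{u}) {x : T.V} (hx : x ≠ T.root) : ∃ y, T.graph.Adj x y := by
  rcases Relation.ReflTransGen.cases_head (T.reach x) with h | ⟨y, hy, -⟩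
  · exact absurd h hx
  · exact ⟨y, hy⟩

theorem cyc_total (m : ℕ) (T : RTree.{u}) (x : ZMod m × T.V) : ∃ y, (cyc m T).Adj x y := by
  by_cases hx : x.2 = T.root
  · exact ⟨(x.1 + 1, T.root), Or.inr ⟨hx, rfl, rfl⟩⟩
  · obtain ⟨y, hy⟩ := T.exists_adj hx
    exact ⟨(x.1, y), Or.inl ⟨rfl, hy⟩⟩

/-- The vertices whose orbit under `f` passes through `r`. -/
def backOrbit {S : Type v} (f : S → S) (r : S) : Set S := {y | ∃ n, f^[n] y = r}

/-- The tree obtained by joining the trees behind the proper preimages of `r` is the tree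
behind `r`. -/
theorem RTree.Realizes.join {S : Type v} {f : S → S} {ι : Type} {T : ι → RTree.{0}} {e : ι → S}
    {r : S} (hT : ∀ i, (T i).Realizes f (e i) (backOrbit f (e i))) (he : Injective e)
    (hrange : ∀ c, (∃ i, e i = c) ↔ f c = r ∧ c ≠ r) (hr : ∀ i n, f^[n] r ≠ e i) :
    (RTree.join T).Realizes f r (backOrbit f r) := by
  choose F hF hroot hadj hFr using hT
  have hfe : ∀ i, f (e i) = r := fun i => ((hrange _).mp ⟨i, rfl⟩).1
  have hback : ∀ i x, ∃ n, f^[n] (F i x) = e i := by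
    intro i x
    have : F i x ∈ backOrbit f (e i) := by rw [← hFr i]; exact ⟨x, rfl⟩
    exact this
  -- After meeting `e i` an orbit enters the forward orbit of r, which avoids every `e j`. Hence no
  -- orbit meets two of these points.
  have key : ∀ i j y n m, f^[n] y = e i → f^[m] y = e j → n ≤ m → i = j := by
    intro i j y n m h1 h2 hnm
    obtain ⟨d, rfl⟩ := Nat.exists_eq_add_of_le' hnm
    rw [iterate_add_apply, h1] at h2
    cases d with
    | zero => exact he h2
    | succ d => rw [iterate_succ_apply, hfe] at h2; exact absurd h2 (hr j d)
  refine ⟨fun x => x.elim r fun p => F p.1 p.2, ?_, rfl, ?_, ?_⟩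
  · rintro (_ | ⟨i, x⟩) (_ | ⟨j, y⟩) hxy
    · rfl
    · obtain ⟨n, hn⟩ := hback j y
      exact absurd (show f^[n] r = e j by rw [← hn]; exact congrArg _ hxy) (hr j n)
    · obtain ⟨n, hn⟩ := hback i x
      exact absurd (show f^[n] r = e i by rw [← hn]; exact congrArg _ hxy.symm) (hr i n)
    · have hxy' : F i x = F j y := hxy
      obtain ⟨n, hn⟩ := hback i x
      obtain ⟨m, hm⟩ := hback j y
      rw [← hxy'] at hm
      have hij : i = j := by
        rcases le_total n m with h | h
        · exact key i j _ n m hn hm h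
        · exact (key j i _ m n hm hn h).symm
      subst hij
      rw [hF i hxy']
  · rintro _ _ (⟨i, x, y, h⟩ | i)
    · exact hadj i x y h
    · change f (F i (T i).root) = r
      rw [hroot, hfe]
  · ext y
    constructor
    · rintro ⟨_ | ⟨i, x⟩, rfl⟩
      · exact ⟨0, rfl⟩
      · obtain ⟨n, hn⟩ := hback i x
        refine ⟨n + 1, ?_⟩
        rw [iterate_succ_apply']
        exact (congrArg f hn).trans (hfe i)
    · rintro ⟨n, hn⟩
      induction n with
      | zero => exact ⟨none, hn.symm⟩
      | succ n ih =>
        by_cases hc : f^[n] y = r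
        · exact ih hc
        · rw [iterate_succ_apply'] at hn
          obtain ⟨i, hi⟩ := (hrange _).mpr ⟨hn, hc⟩
          have : y ∈ Set.range (F i) := by rw [hFr i]; exact ⟨n, hi.symm⟩
          obtain ⟨x, hx⟩ := this
          exact ⟨some ⟨i, x⟩, hx⟩

/-! ### Periodic orbits -/

theorem exists_cyclic_parametrization {S : Type v} (f : S → S) (w : S) {m : ℕ} (hm : 0 < m)
    (hw : minimalPeriod f w = m) :
    ∃ o : ZMod m → S, Injective o ∧ (∀ j, o (j + 1) = f (o j)) ∧ ∀ n : ℕ, o n = f^[n] w := by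
  have : NeZero m := ⟨hm.ne'⟩
  have ho : ∀ n : ℕ, f^[(n : ZMod m).val] w = f^[n] w := by
    intro n
    rw [ZMod.val_natCast, ← hw, iterate_mod_minimalPeriod_eq]
  refine ⟨fun j => f^[j.val] w, ?_, ?_, ho⟩
  · intro i j hij
    apply ZMod.val_injective m
    refine (iterate_eq_iterate_iff_of_lt_minimalPeriod ?_ ?_).mp hij
    · rw [hw]; exact ZMod.val_lt i
    · rw [hw]; exact ZMod.val_lt j
  · intro j
    obtain ⟨n, rfl⟩ := ZMod.natCast_zmod_surjective j
    have := ho (n + 1)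
    push_cast at this
    dsimp only
    rw [this, ho n, iterate_succ_apply']

/-- A finite set on which all orbits are cycles of length `m` has a system of representatives of its
orbits. -/
theorem exists_orbit_representatives {S : Type v} (f : S → S) (W : Set S) (hfin : W.Finite)
    (hf : ∀ w ∈ W, f w ∈ W) {m : ℕ} (hm : 0 < m) (hW : ∀ w ∈ W, minimalPeriod f w = m) :
    ∃ r : Fin (W.ncard / m) → S, (∀ i, r i ∈ W) ∧ (∀ w ∈ W, ∃ i n, f^[n] (r i) = w) ∧
      ∀ i j a b, f^[a] (r i) = f^[b] (r j) → i = j := by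
  have : NeZero m := ⟨hm.ne'⟩
  have : Finite W := hfin
  have hiter : ∀ (w : W) (n : ℕ), f^[n] w.1 ∈ W := by
    intro w n
    induction n with
    | zero => exact w.2
    | succ n ih => rw [iterate_succ_apply']; exact hf _ ih
  -- Together, n and (m - 1) n steps make n full turns. Reachability on W is therefore symmetric.
  have hback : ∀ (w : W) (n : ℕ), f^[(m - 1) * n] (f^[n] w.1) = w.1 := by
    intro w n
    rw [← iterate_add_apply]
    have : (m - 1) * n + n = m * n := by
      rw [Nat.sub_mul, one_mul, Nat.sub_add_cancel (Nat.le_mul_of_pos_left n hm)]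
    rw [this]
    have hp : IsPeriodicPt f m w.1 := by rw [← hW w.1 w.2]; exact isPeriodicPt_minimalPeriod f _
    exact hp.mul_const n
  let s : Setoid W :=
    { r := fun a b => ∃ n, f^[n] a.1 = b.1
      iseqv :=
        { refl := fun a => ⟨0, rfl⟩
          symm := by
            rintro a b ⟨n, hn⟩
            exact ⟨(m - 1) * n, by rw [← hn, hback]⟩
          trans := by
            rintro a b c ⟨n, hn⟩ ⟨l, hl⟩
            exact ⟨l + n, by rw [iterate_add_apply, hn, hl]⟩ } }
  choose o ho hsucc hcast using fun w : W => exists_cyclic_parametrization f w.1 hm (hW w.1 w.2)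
  have homem : ∀ w j, o w j ∈ W := by
    intro w j
    obtain ⟨n, rfl⟩ := ZMod.natCast_zmod_surjective j
    rw [hcast]
    exact hiter w n
  -- A class and a position on its cycle determine a point of W, which gives the number of classes.
  let Φ : Quotient s × ZMod m → W := fun p => ⟨o p.1.out p.2, homem _ _⟩
  have hsame : ∀ (p q : Quotient s) (a b : ℕ), f^[a] p.out.1 = f^[b] q.out.1 → p = q := by
    intro p q a b h
    rw [← Quotient.out_eq p, ← Quotient.out_eq q]
    refine Quotient.sound ⟨(m - 1) * b + a, ?_⟩
    rw [iterate_add_apply, h, hback]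
  have hΦ : Bijective Φ := by
    constructor
    · rintro ⟨p, i⟩ ⟨q, j⟩ h
      have h' : o p.out i = o q.out j := congrArg Subtype.val h
      have hpq : p = q := by
        obtain ⟨a, ha⟩ := ZMod.natCast_zmod_surjective i
        obtain ⟨b, hb⟩ := ZMod.natCast_zmod_surjective j
        rw [← ha, ← hb, hcast, hcast] at h'
        exact hsame p q a b h'
      subst hpq
      rw [ho _ h']
    · intro w
      obtain ⟨n, hn⟩ : ∃ n, f^[n] (Quotient.mk s w).out.1 = w.1 := Quotient.mk_out (s := s) w
      exact ⟨(Quotient.mk s w, (n : ZMod m)), Subtype.ext ((hcast _ n).trans hn)⟩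
  have hcard : Nat.card (Quotient s) = W.ncard / m := by
    have h := Nat.card_congr (Equiv.ofBijective Φ hΦ)
    rw [Nat.card_prod, Nat.card_zmod, Nat.card_coe_set_eq] at h
    rw [← h, Nat.mul_div_cancel _ hm]
  let ε := (Finite.equivFinOfCardEq hcard).symm
  refine ⟨fun i => (ε i).out.1, fun i => (ε i).out.2, ?_, ?_⟩
  · intro w hw
    obtain ⟨n, hn⟩ : ∃ n, f^[n] (Quotient.mk s ⟨w, hw⟩).out.1 = w :=
      Quotient.mk_out (s := s) ⟨w, hw⟩
    refine ⟨ε.symm (Quotient.mk s ⟨w, hw⟩), n, ?_⟩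
    dsimp only
    rw [Equiv.apply_symm_apply]
    exact hn
  · intro i j a b h
    exact ε.injective (hsame _ _ a b h)

/-- The distance to `x` along the orbits of `f`. -/
theorem exists_depth {S : Type v} (f : S → S) (x : S) :
    ∃ δ : S → ℕ, δ x = 0 ∧ ∀ y ∈ backOrbit f x, y ≠ x → δ y = δ (f y) + 1 := by
  classical
  refine ⟨fun y => if h : ∃ n, f^[n] y = x then Nat.find h else 0, ?_, ?_⟩
  · have h : ∃ n, f^[n] x = x := ⟨0, rfl⟩
    dsimp only
    rw [dif_pos h, Nat.find_eq_zero]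
    rfl
  · intro y hy hyx
    have h0 : ¬ f^[0] y = x := hyx
    have h : ∃ n, f^[n] (f y) = x := by
      obtain ⟨_ | n, hn⟩ := hy
      · exact absurd hn hyx
      · exact ⟨n, hn⟩
    have hy' : ∃ n, f^[n] y = x := hy
    dsimp only
    rw [dif_pos hy', dif_pos h]
    exact Nat.find_comp_succ hy' h h0

/-! ### Arithmetic of the iterated gcd -/

/-- Writing n = g a and t^j = g b with a, b coprime gives gcd(n, t^(j+1)) = g gcd(t, a). The closed
form is the order of the subgroup of t^j-th powers in a cyclic group of order n. -/
theorem gcdRem_eq (t n : ℕ) (hn : 0 < n) (j : ℕ) : gcdRem t n j = n / Nat.gcd n (t ^ j) := by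
  induction j with
  | zero => simp [gcdRem]
  | succ j ih =>
    obtain ⟨g, a, b, hg, hab, ha, hb⟩ := Nat.exists_coprime' (m := n) (n := t ^ j)
      (Nat.gcd_pos_of_pos_left _ hn)
    have hgcd : Nat.gcd n (t ^ j) = g := by rw [ha, hb, Nat.gcd_mul_right, hab.gcd_eq_one, one_mul]
    have hgcd' : Nat.gcd n (t ^ (j + 1)) = g * Nat.gcd t a := by
      rw [pow_succ, hb, ha, mul_comm b g, mul_assoc, mul_comm a g, Nat.gcd_mul_left,
        Nat.Coprime.gcd_mul_left_cancel_right t hab.symm, Nat.gcd_comm]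
    rw [gcdRem, ih, hgcd, hgcd', ← Nat.div_div_eq_div_mul]
    congr 2
    rw [ha, Nat.mul_div_cancel _ hg]

theorem gcdSeq_mul_coprime {t ν ω : ℕ} (hν : 0 < ν) (hω : 0 < ω) (h : Nat.Coprime ω t) (j : ℕ) :
    gcdSeq t (ν * ω) j = gcdSeq t ν j := by
  have h1 : Nat.gcd (ν * ω) (t ^ j) = Nat.gcd ν (t ^ j) :=
    (h.pow_right j).gcd_mul_right_cancel ν
  rw [gcdSeq, gcdSeq, gcdRem_eq t _ (Nat.mul_pos hν hω), gcdRem_eq t _ hν, h1,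
    ← Nat.div_mul_right_comm (Nat.gcd_dvd_left _ _), Nat.Coprime.gcd_mul_right_cancel_right _ h]

theorem gcdLength_spec {t ν K : ℕ} (hν : 0 < ν) (h : ν ∣ t ^ K) :
    0 < gcdLength t ν ∧ gcdSeq t ν (gcdLength t ν) = 1 := by
  -- The witness K + 1 is positive even for K = 0, and it excludes the default value of `sInf` on
  -- the empty set.
  refine Nat.sInf_mem (s := {D | 0 < D ∧ gcdSeq t ν D = 1}) ⟨K + 1, K.succ_pos, ?_⟩
  have : ν ∣ t ^ (K + 1) := h.trans (pow_dvd_pow t K.le_succ)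
  rw [gcdSeq, gcdRem_eq t ν hν, Nat.gcd_eq_left this, Nat.div_self hν, Nat.gcd_one_right]

/-! ### The tree of the identity in a cyclic group -/

theorem powerMap_iterate {G : Type u} [Group G] (t n : ℕ) (g : G) :
    (powerMap G t)^[n] g = g ^ t ^ n := by
  induction n with
  | zero => simp
  | succ n ih => rw [iterate_succ_apply', ih, powerMap, ← pow_mul, pow_succ]

/-- `u` is a `t ^ j`-th power. -/
def IsIterPow {G : Type u} [Group G] (t j : ℕ) (u : G) : Prop := ∃ x : G, x ^ t ^ j = u

/-- `u` is a `t ^ j`-th power, but not a `t ^ (j + 1)`-st power. -/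
def HasPowHeight {G : Type u} [Group G] (t j : ℕ) (u : G) : Prop :=
  IsIterPow t j u ∧ ¬ IsIterPow t (j + 1) u

section
variable {G : Type u} [Group G] {t : ℕ}

theorem isIterPow_one (j : ℕ) : IsIterPow t j (1 : G) := ⟨1, one_pow _⟩

theorem IsIterPow.of_le {i j : ℕ} {u : G} (h : IsIterPow t j u) (hij : i ≤ j) :
    IsIterPow t i u := by
  obtain ⟨x, rfl⟩ := h
  obtain ⟨d, rfl⟩ := Nat.exists_eq_add_of_le hij
  exact ⟨x ^ t ^ d, by rw [← pow_mul, ← pow_add, add_comm]⟩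

theorem IsIterPow.pow {j : ℕ} {u : G} (h : IsIterPow t j u) : IsIterPow t (j + 1) (u ^ t) := by
  obtain ⟨x, rfl⟩ := h
  exact ⟨x, by rw [pow_succ, pow_mul]⟩

theorem IsIterPow.pow_iterate {j : ℕ} {u : G} (h : IsIterPow t j u) (n : ℕ) :
    IsIterPow t j (u ^ t ^ n) := by
  obtain ⟨x, rfl⟩ := h
  exact ⟨x ^ t ^ n, by rw [← pow_mul, ← pow_mul, mul_comm]⟩

theorem HasPowHeight.unique {i j : ℕ} {u : G} (hi : HasPowHeight t i u) (hj : HasPowHeight t j u) :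
    i = j := by
  rcases lt_trichotomy i j with h | h | h
  · exact absurd (hj.1.of_le h) hi.2
  · exact h
  · exact absurd (hi.1.of_le h) hj.2

theorem exists_hasPowHeight {k : ℕ} {u : G} (h : ¬ IsIterPow t (k + 1) u) :
    ∃ i ≤ k, HasPowHeight t i u := by
  induction k with
  | zero => exact ⟨0, le_rfl, ⟨u, by simp⟩, h⟩
  | succ k ih =>
    by_cases hk : IsIterPow t (k + 1) u
    · exact ⟨k + 1, le_rfl, hk, h⟩
    · obtain ⟨i, hi, hu⟩ := ih hk
      exact ⟨i, hi.trans k.le_succ, hu⟩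

/-- The tree behind `r` is the join of the trees behind its proper `t`-th roots, sorted by their
heights. -/
theorem join_realizes_of_card (T : ℕ → RTree.{0}) (N : ℕ → ℕ) (n k : ℕ) (r : G)
    (hT : ∀ i ≤ k, ∀ u : G, HasPowHeight t i u →
      (T i).Realizes (powerMap G t) u (backOrbit (powerMap G t) u))
    (hN : ∀ i < k, Nat.card {y : G // y ^ t = r ∧ HasPowHeight t i y} = N i)
    (hn : Nat.card {y : G // y ^ t = r ∧ HasPowHeight t k y} = n) [Finite G]
    (hroots : ∀ c : G, c ^ t = r → c ≠ r → ¬ IsIterPow t (k + 1) c)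
    (hr : IsIterPow t (k + 1) r) :
    (RTree.join (ι := Fin n ⊕ (Σ i : Fin k, Fin (N i)))
      (Sum.elim (fun _ => T k) (fun p => T p.1.1))).Realizes (powerMap G t) r
        (backOrbit (powerMap G t) r) := by
  let a := (Finite.equivFinOfCardEq hn).symm
  let b := fun i : Fin k => (Finite.equivFinOfCardEq (hN i i.2)).symm
  let e : Fin n ⊕ (Σ i : Fin k, Fin (N i)) → G :=
    Sum.elim (fun x => (a x).1) (fun p => (b p.1 p.2).1)
  have hnot : ∀ {i : ℕ} {u : G}, i ≤ k → IsIterPow t (k + 1) u → ¬ HasPowHeight t i u :=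
    fun hi hu h => h.2 (hu.of_le (Nat.succ_le_succ hi))
  refine RTree.Realizes.join (e := e) ?_ ?_ ?_ ?_
  · rintro (x | ⟨i, x⟩)
    · exact hT k le_rfl _ (a x).2.2
    · exact hT i i.2.le _ (b i x).2.2
  · rintro (x | ⟨i, x⟩) (y | ⟨j, y⟩) hxy
    · rw [a.injective (Subtype.ext hxy)]
    · have h1 := (a x).2.2
      rw [show (a x).1 = (b j y).1 from hxy] at h1
      exact absurd (h1.unique (b j y).2.2) j.2.ne'
    · have h1 := (a y).2.2
      rw [← show (b i x).1 = (a y).1 from hxy] at h1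
      exact absurd (h1.unique (b i x).2.2) i.2.ne'
    · have hxy' : (b i x).1 = (b j y).1 := hxy
      have h1 := (b i x).2.2
      rw [hxy'] at h1
      have hij : i = j := Fin.ext (h1.unique (b j y).2.2)
      subst hij
      rw [(b i).injective (Subtype.ext hxy')]
  · intro c
    constructor
    · rintro ⟨x | ⟨i, x⟩, rfl⟩
      · refine ⟨(a x).2.1, fun h => hnot le_rfl hr (h ▸ (a x).2.2)⟩
      · refine ⟨(b i x).2.1, fun h => hnot i.2.le hr (h ▸ (b i x).2.2)⟩
    · rintro ⟨h1, h2⟩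
      obtain ⟨i, hi, hc⟩ := exists_hasPowHeight (hroots c h1 h2)
      rcases hi.eq_or_lt with rfl | hi
      · exact ⟨Sum.inl (a.symm ⟨c, h1, hc⟩), by simp [e]⟩
      · exact ⟨Sum.inr ⟨⟨i, hi⟩, (b ⟨i, hi⟩).symm ⟨c, h1, hc⟩⟩, by simp [e]⟩
  · rintro (x | ⟨i, x⟩) m h
    · rw [powerMap_iterate] at h
      exact hnot le_rfl (hr.pow_iterate m) (h ▸ (a x).2.2)
    · rw [powerMap_iterate] at h
      exact hnot i.2.le (hr.pow_iterate m) (h ▸ (b i x).2.2)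

end

/-! ### Counting roots by height in a cyclic group -/

section
variable {C : Type u} [Group C] [Finite C] [IsCyclic C] {t : ℕ}

/-- Inside the subgroup of t^j-th powers, the t-th roots of u form a coset of the kernel of `y ↦ y ^
t`. The coset is nonempty because u is a t^(j+1)-th power. -/
theorem card_roots_isIterPow {j : ℕ} {u : C} (hu : IsIterPow t (j + 1) u) :
    Nat.card {y : C // y ^ t = u ∧ IsIterPow t j y} = gcdSeq t (Nat.card C) j := by
  let : CommGroup C := IsCyclic.commGroup
  let H : Subgroup C := (powMonoidHom (t ^ j) : C →* C).range
  have hH : Nat.card H = gcdRem t (Nat.card C) j := by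
    rw [gcdRem_eq t _ Nat.card_pos]
    exact IsCyclic.card_powMonoidHom_range C (t ^ j)
  rw [gcdSeq, ← hH, Nat.gcd_comm, ← IsCyclic.card_powMonoidHom_ker]
  obtain ⟨x, hx⟩ := hu
  have hx' : (x ^ t ^ j) ^ t = u := by rw [← hx, pow_succ, pow_mul]
  symm
  refine Nat.card_congr (Equiv.ofBijective
    (fun z => ⟨x ^ t ^ j * z.1.1, ?_, ?_⟩) ⟨?_, ?_⟩)
  · have hz : (z.1.1) ^ t = 1 := congrArg Subtype.val z.2
    rw [mul_pow, hx', hz, mul_one]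
  · obtain ⟨⟨_, y, rfl⟩, -⟩ := z
    exact ⟨x * y, mul_pow _ _ _⟩
  · intro z z' h
    exact Subtype.ext (Subtype.ext (mul_left_cancel (congrArg Subtype.val h)))
  · rintro ⟨y, hy, v, rfl⟩
    refine ⟨⟨⟨(x ^ t ^ j)⁻¹ * v ^ t ^ j, ⟨x⁻¹ * v, ?_⟩⟩, ?_⟩, ?_⟩
    · simp [mul_pow]
    · refine Subtype.ext ?_
      change ((x ^ t ^ j)⁻¹ * v ^ t ^ j) ^ t = 1
      rw [mul_pow, inv_pow, hx', hy, inv_mul_cancel]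
    · exact Subtype.ext (mul_inv_cancel_left _ _)

theorem card_roots_hasPowHeight {j : ℕ} {u : C} (hu : IsIterPow t (j + 2) u) :
    Nat.card {y : C // y ^ t = u ∧ HasPowHeight t j y} =
      gcdSeq t (Nat.card C) j - gcdSeq t (Nat.card C) (j + 1) := by
  rw [← card_roots_isIterPow (hu.of_le (Nat.le_succ _)), ← card_roots_isIterPow hu]
  change Nat.card ({y | y ^ t = u ∧ HasPowHeight t j y} : Set C) =
    Nat.card ({y | y ^ t = u ∧ IsIterPow t j y} : Set C) -
      Nat.card ({y | y ^ t = u ∧ IsIterPow t (j + 1) y} : Set C)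
  simp only [Nat.card_coe_set_eq]
  have hsub : ({y | y ^ t = u ∧ IsIterPow t (j + 1) y} : Set C) ⊆
      {y | y ^ t = u ∧ IsIterPow t j y} :=
    fun y hy => ⟨hy.1, hy.2.of_le j.le_succ⟩
  rw [← Set.ncard_sdiff hsub]
  congr 1
  ext y
  simp only [HasPowHeight, Set.mem_ofPred_eq, Set.mem_sdiff]
  tauto

/-- A t-th root of a vertex of height k + 1 has height at most k. Roots of height i < k are counted
by a difference of consecutive terms. At height k nothing is subtracted, since no root is a
t^(k+1)-th power. -/
theorem elementarySubtree_realizes (h : ℕ) (u : C) (hu : HasPowHeight t h u) :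
    (elementarySubtree (gcdSeq t (Nat.card C)) h).Realizes (powerMap C t) u
      (backOrbit (powerMap C t) u) := by
  induction h using Nat.strong_induction_on generalizing u with
  | _ h ih =>
  cases h with
  | zero =>
    rw [elementarySubtree]
    refine ⟨fun _ => u, fun _ _ _ => rfl, rfl, fun _ _ h => h.elim, ?_⟩
    ext y
    constructor
    · rintro ⟨_, rfl⟩
      exact ⟨0, rfl⟩
    · rintro ⟨_ | n, hn⟩
      · exact ⟨(), hn.symm⟩
      · rw [iterate_succ_apply', powerMap_iterate] at hn
        exact absurd ⟨y ^ t ^ n, by rw [← hn]; simp [powerMap]⟩ hu.2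
  | succ k =>
    rw [elementarySubtree]
    have hc : ∀ c : C, c ^ t = u → ¬ IsIterPow t (k + 1) c := by
      rintro c rfl hc
      exact hu.2 hc.pow
    refine join_realizes_of_card (elementarySubtree (gcdSeq t (Nat.card C)))
      (fun i => gcdSeq t (Nat.card C) i - gcdSeq t (Nat.card C) (i + 1)) _ k u
      (fun i hi u hu => ih i (Nat.lt_succ_of_le hi) u hu)
      (fun i hi => card_roots_hasPowHeight (hu.1.of_le (by omega))) ?_
      (fun c h1 _ => hc c h1) hu.1
    rw [← card_roots_isIterPow hu.1]
    refine Nat.card_congr (Equiv.subtypeEquivRight fun y => ?_)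
    exact ⟨fun h => ⟨h.1, h.2.1⟩, fun h => ⟨h.1, h.2, hc y h.1⟩⟩

/-- The identity is a t^j-th power for every j, so here the top level is a difference too. The final
term 1 says that 1 is its only t-th root of greater height, and this root is the one to discard. -/
theorem elementaryTree_realizes {e : ℕ} (he : 0 < e) (h1 : gcdSeq t (Nat.card C) e = 1) :
    (elementaryTree (gcdSeq t (Nat.card C)) e).Realizes (powerMap C t) 1
      (backOrbit (powerMap C t) 1) := by
  obtain ⟨e, rfl⟩ := Nat.exists_eq_succ_of_ne_zero he.ne'
  rw [elementaryTree]
  refine join_realizes_of_card (elementarySubtree (gcdSeq t (Nat.card C)))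
    (fun i => gcdSeq t (Nat.card C) i - gcdSeq t (Nat.card C) (i + 1)) _ e 1
    (fun i _ u hu => elementarySubtree_realizes i u hu)
    (fun i _ => card_roots_hasPowHeight (isIterPow_one _)) ?_ ?_ (isIterPow_one _)
  · rw [card_roots_hasPowHeight (isIterPow_one _), h1]
  · intro c hc hc1 hpow
    have hcard := card_roots_isIterPow (t := t) (j := e + 1) (isIterPow_one (G := C) _)
    rw [h1, Nat.card_eq_one_iff_unique] at hcard
    have := hcard.1
    exact hc1 (congrArg Subtype.val (Subsingleton.elim
      (⟨c, hc, hpow⟩ : {y : C // y ^ t = 1 ∧ IsIterPow t (e + 1) y})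
      ⟨1, one_pow _, isIterPow_one _⟩))

end

/-- In a cyclic subgroup of order `ν * ω`, with `ω` coprime to `t` and `ν` dividing a power of `t`,
the elements that are killed by a power of `t` form the elementary tree of `gcd_t(ν)`. -/
theorem gcdTree_realizes {G : Type u} [Group G] (C : Subgroup G) [Finite C] [IsCyclic C]
    {t ν ω K : ℕ} (hC : Nat.card C = ν * ω) (hω : Nat.Coprime ω t) (hν : ν ∣ t ^ K) :
    (gcdTree t ν).Realizes (powerMap G t) 1 {y | y ∈ C ∧ y ∈ backOrbit (powerMap G t) 1} := by
  have hpos : 0 < ν * ω := hC ▸ Nat.card_pos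
  have hν0 := Nat.pos_of_mul_pos_right hpos
  have hω0 := Nat.pos_of_mul_pos_left hpos
  obtain ⟨hD, hD1⟩ := gcdLength_spec hν0 hν
  have hseq : gcdSeq t (Nat.card C) = gcdSeq t ν := by
    funext j
    rw [hC, gcdSeq_mul_coprime hν0 hω0 hω]
  have := elementaryTree_realizes (C := C) (t := t) hD (by rw [hseq, hD1])
  rw [hseq] at this
  obtain ⟨F, hF, hroot, hadj, hrange⟩ := this
  refine ⟨fun x => (F x).1, Subtype.val_injective.comp hF, congrArg Subtype.val hroot,
    fun x y h => congrArg Subtype.val (hadj x y h), ?_⟩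
  ext y
  simp only [Set.ext_iff, backOrbit, powerMap_iterate, Set.mem_range, Set.mem_ofPred_eq] at hrange ⊢
  constructor
  · rintro ⟨x, rfl⟩
    obtain ⟨n, hn⟩ := (hrange (F x)).mp ⟨x, rfl⟩
    exact ⟨(F x).2, n, congrArg Subtype.val hn⟩
  · rintro ⟨hy, n, hn⟩
    obtain ⟨x, hx⟩ := (hrange ⟨y, hy⟩).mpr ⟨n, Subtype.ext hn⟩
    exact ⟨x, congrArg Subtype.val hx⟩

/-! ### The idempotent power of the power map -/

/-- Some iterate of a self-map of a finite set is idempotent. -/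
theorem exists_iterate_idempotent {S : Type v} [Finite S] (f : S → S) :
    ∃ K, 0 < K ∧ f^[K + K] = f^[K] := by
  obtain ⟨a, b, hab, h⟩ := Finite.exists_ne_map_eq_of_infinite fun n : ℕ => f^[n]
  wlog hlt : a < b generalizing a b
  · exact this b a hab.symm h.symm (lt_of_le_of_ne (not_lt.mp hlt) hab.symm)
  obtain ⟨p, rfl⟩ := Nat.exists_eq_add_of_lt hlt
  have hstep : ∀ n, a ≤ n → f^[n + (p + 1)] = f^[n] := by
    intro n hn
    obtain ⟨d, rfl⟩ := Nat.exists_eq_add_of_le' hn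
    rw [add_assoc, iterate_add, iterate_add f d a]
    exact congrArg _ h.symm
  have hmul : ∀ s n, a ≤ n → f^[n + (p + 1) * s] = f^[n] := by
    intro s
    induction s with
    | zero => intro n _; rfl
    | succ s ih =>
      intro n hn
      rw [mul_add, mul_one, ← add_assoc, hstep _ (hn.trans (Nat.le_add_right _ _)), ih n hn]
  -- A positive multiple of the period p + 1 that is at least the preperiod a.
  refine ⟨(p + 1) * (a + 1), by positivity, hmul _ _ ?_⟩
  nlinarith

section
variable {G : Type u} [Group G] {t K : ℕ}

theorem exists_pow_idempotent (G : Type u) [Group G] [Finite G] (t : ℕ) :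
    ∃ K, 0 < K ∧ ∀ g : G, (g ^ t ^ K) ^ t ^ K = g ^ t ^ K := by
  obtain ⟨K, hK, h⟩ := exists_iterate_idempotent (powerMap G t)
  refine ⟨K, hK, fun g => ?_⟩
  have := congrFun h g
  rwa [iterate_add_apply, powerMap_iterate, powerMap_iterate] at this

theorem mem_backOrbit_one_iff (hK : 0 < K) (hidem : ∀ g : G, (g ^ t ^ K) ^ t ^ K = g ^ t ^ K)
    (u : G) : u ∈ backOrbit (powerMap G t) 1 ↔ u ^ t ^ K = 1 := by
  constructor
  · rintro ⟨n, hn⟩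
    rw [powerMap_iterate] at hn
    have hmul : ∀ s, u ^ t ^ (K * (s + 1)) = u ^ t ^ K := by
      intro s
      induction s with
      | zero => simp
      | succ s ih => rw [mul_add, mul_one, pow_add, pow_mul, ih, hidem]
    obtain ⟨d, hd⟩ := Nat.exists_eq_add_of_le (show n ≤ K * (n + 1) by nlinarith)
    rw [← hmul n, hd, pow_add, pow_mul, hn, one_pow]
  · intro h
    exact ⟨K, by rw [powerMap_iterate, h]⟩

/-- Raising w to the power t^K divides its order by gcd(`orderOf w`, t^K), so a fixed w forces this
gcd to be 1. Conversely, t^K cancels from the congruence expressing idempotence. -/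
theorem pow_eq_self_iff_coprime [Finite G] (hK : 0 < K)
    (hidem : ∀ g : G, (g ^ t ^ K) ^ t ^ K = g ^ t ^ K) (w : G) :
    w ^ t ^ K = w ↔ Nat.Coprime (orderOf w) t := by
  constructor
  · intro h
    rw [← Nat.coprime_pow_right_iff hK]
    by_contra hne
    have h1 := orderOf_pow (n := t ^ K) w
    rw [h] at h1
    have h2 := Nat.div_lt_self (orderOf_pos w) (lt_of_le_of_ne
      (Nat.gcd_pos_of_pos_left (t ^ K) (orderOf_pos w)) (Ne.symm hne))
    omega
  · intro h
    have h1 := hidem w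
    rw [← pow_mul, pow_eq_pow_iff_modEq] at h1
    have h2 : t ^ K * t ^ K ≡ t ^ K * 1 [MOD orderOf w] := by rwa [mul_one]
    have h3 := Nat.ModEq.cancel_left_of_coprime (h.pow_right K) h2
    simpa using pow_eq_pow_iff_modEq.mpr h3

theorem minimalPeriod_powerMap (t : ℕ) (w : G) :
    minimalPeriod (powerMap G t) w = ordMod (orderOf w) t := by
  refine minimalPeriod_eq_minimalPeriod_iff.mpr fun n => ?_
  rw [isPeriodicPt_mul_iff_pow_eq_one, IsPeriodicPt, IsFixedPt, powerMap_iterate]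
  have h : w ^ t ^ n = w ↔ w ^ t ^ n = w ^ 1 := by rw [pow_one]
  rw [h, pow_eq_pow_iff_modEq, ← ZMod.natCast_eq_natCast_iff]
  push_cast
  rfl

/-- The identity is fixed, so a periodic point whose orbit reaches 1 must equal 1. No point before
the first visit to 1 is periodic. -/
theorem inAttachedTree_one_iff (y : G) :
    InAttachedTree (powerMap G t) 1 y ↔ y ∈ backOrbit (powerMap G t) 1 := by
  classical
  constructor
  · rintro ⟨n, hn, -⟩
    exact ⟨n, hn⟩
  · intro hy
    have hy' : ∃ n, (powerMap G t)^[n] y = 1 := hy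
    refine ⟨Nat.find hy', Nat.find_spec hy', fun m hm hper => Nat.find_min hy' hm ?_⟩
    obtain ⟨p, hp, hper⟩ := hper
    obtain ⟨d, hd⟩ := Nat.exists_eq_add_of_le' hm.le
    have hone := Nat.find_spec hy'
    rw [hd, iterate_add_apply] at hone
    have hpd : IsPeriodicPt (powerMap G t) (p * d) ((powerMap G t)^[m] y) := hper.mul_const d
    obtain ⟨q, hq⟩ := Nat.exists_eq_add_of_le' (Nat.le_mul_of_pos_left d hp)
    rw [← hpd.eq, hq, iterate_add_apply, hone, powerMap_iterate, one_pow]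

theorem centralTree_realizes (t : ℕ) :
    (centralTree t G).Realizes (powerMap G t) 1 (backOrbit (powerMap G t) 1) := by
  refine ⟨Subtype.val, Subtype.val_injective, rfl, fun x y h => h.2, ?_⟩
  ext y
  rw [← inAttachedTree_one_iff]
  exact ⟨fun ⟨x, hx⟩ => hx ▸ x.2, fun hy => ⟨⟨y, hy⟩, rfl⟩⟩

/-! ### Blocks of cycles -/

/-- The q-th power kills the first factor and fixes the second. -/
theorem eq_of_mul_eq_mul_of_pow {q : ℕ} {x y x' y' : G} (h : x * y = x' * y') (hc : Commute x y)
    (hc' : Commute x' y') (hx : x ^ q = 1) (hx' : x' ^ q = 1) (hy : y ^ q = y)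
    (hy' : y' ^ q = y') : y = y' := by
  have := congrArg (· ^ q) h
  simpa only [hc.mul_pow, hc'.mul_pow, hx, hx', hy, hy', one_mul] using this

/-- The cycle of `w`, with a copy of the tree `U` behind each of its points. -/
theorem cyc_realizes {T : RTree.{v}} {U : Set G} (hT : T.Realizes (powerMap G t) 1 U)
    (hU : ∀ x ∈ U, x ^ t ^ K = 1) {w : G} (hw : w ^ t ^ K = w) (hc : ∀ x ∈ U, Commute x w)
    {m : ℕ} (hm : 0 < m) (hper : minimalPeriod (powerMap G t) w = m) :
    Realizes (cyc m T) (powerMap G t) {g | ∃ x ∈ U, ∃ n : ℕ, x * w ^ t ^ n = g} := by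
  obtain ⟨E, hE, hroot, hadj, hrange⟩ := hT
  obtain ⟨o, ho, hsucc, hcast⟩ := exists_cyclic_parametrization (powerMap G t) w hm hper
  obtain ⟨δ, hδ1, hδ⟩ := exists_depth (powerMap G t) (1 : G)
  have hmem : ∀ x, E x ∈ U := fun x => hrange ▸ ⟨x, rfl⟩
  have hox : ∀ j, ∃ n : ℕ, o j = w ^ t ^ n := by
    have : NeZero m := ⟨hm.ne'⟩
    intro j
    obtain ⟨n, rfl⟩ := ZMod.natCast_zmod_surjective j
    exact ⟨n, by rw [hcast, powerMap_iterate]⟩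
  have hoK : ∀ j, o j ^ t ^ K = o j := by
    intro j
    obtain ⟨n, hn⟩ := hox j
    rw [hn, pow_right_comm, hw]
  have hoc : ∀ x ∈ U, ∀ j, Commute x (o j) := by
    intro x hx j
    obtain ⟨n, hn⟩ := hox j
    rw [hn]
    exact (hc x hx).pow_right _
  have hEroot : ∀ x, E x = 1 → x = T.root := fun x hx => hE (hx.trans hroot.symm)
  -- The power map moves both factors at once, so a step down the tree also advances `o`.
  -- Subtracting the depth δ compensates for this and keeps the cycle coordinate constant until the
  -- root is reached.
  refine ⟨cyc_total m T, fun p => E p.2 * o (p.1 - δ (E p.2)), ?_, ?_, ?_⟩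
  · rintro ⟨a, x⟩ ⟨b, y⟩ h
    dsimp only at h
    have h1 := eq_of_mul_eq_mul_of_pow h (hoc _ (hmem x) _) (hoc _ (hmem y) _) (hU _ (hmem x))
      (hU _ (hmem y)) (hoK _) (hoK _)
    rw [h1] at h
    have hxy : x = y := hE (mul_right_cancel h)
    subst hxy
    rw [sub_left_injective (ho h1)]
  · rintro ⟨a, x⟩ ⟨b, y⟩ (⟨h1, h2⟩ | ⟨h1, h2, h3⟩)
    · dsimp only at h1 h2
      subst h1
      have hx1 : E x ≠ 1 := fun h => T.root_sink y (hEroot x h ▸ h2)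
      have hEx : powerMap G t (E x) = E y := hadj x y h2
      have hδx := hδ (E x) ⟨K, by rw [powerMap_iterate, hU _ (hmem x)]⟩ hx1
      rw [hEx] at hδx
      have hmul : powerMap G t (E x * o (a - δ (E x))) =
          powerMap G t (E x) * powerMap G t (o (a - δ (E x))) := (hoc _ (hmem x) _).mul_pow t
      dsimp only
      rw [hmul, hEx, ← hsucc, hδx]
      congr 2
      push_cast
      ring
    · dsimp only at h1 h2 h3
      subst h1 h2 h3
      simp only [hroot, hδ1, Nat.cast_zero, sub_zero, one_mul, hsucc]
  · ext g
    constructor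
    · rintro ⟨⟨a, x⟩, rfl⟩
      obtain ⟨n, hn⟩ := hox (a - δ (E x))
      exact ⟨E x, hmem x, n, congrArg (E x * ·) hn.symm⟩
    · rintro ⟨x, hx, n, rfl⟩
      rw [← hrange] at hx
      obtain ⟨x, rfl⟩ := hx
      refine ⟨((n : ZMod m) + δ (E x), x), ?_⟩
      dsimp only
      rw [add_sub_cancel_right, hcast, powerMap_iterate]

theorem ncard_orderOf_eq (C : Subgroup G) [Finite C] [IsCyclic C] {d : ℕ} (hd : d ∣ Nat.card C) :
    {w | w ∈ C ∧ orderOf w = d}.ncard = Nat.totient d := by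
  classical
  have := Fintype.ofFinite C
  rw [Nat.card_eq_fintype_card] at hd
  rw [← IsCyclic.card_orderOf_eq_totient hd, ← Set.ncard_coe_finset,
    ← Set.ncard_image_of_injective _ Subtype.val_injective]
  congr 1
  ext w
  simp [and_comm]

/-- The φ(d) elements of order d in C are permuted in cycles of length `ordMod d t`. Each cycle,
multiplied by U, is one copy, and uniqueness of the splitting makes the copies disjoint. -/
theorem cycleBlock_realizes [Finite G] (hK : 0 < K)
    (hidem : ∀ g : G, (g ^ t ^ K) ^ t ^ K = g ^ t ^ K)
    {T : RTree.{v}} {U : Set G} (hT : T.Realizes (powerMap G t) 1 U)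
    (hU : ∀ x ∈ U, x ^ t ^ K = 1) (C : Subgroup G) [IsCyclic C]
    (hc : ∀ x ∈ U, ∀ w ∈ C, Commute x w) {d : ℕ} (hd : d ∣ Nat.card C) (hdt : Nat.Coprime d t) :
    Realizes (cycleBlock t d T) (powerMap G t)
      {g | ∃ x ∈ U, ∃ w ∈ C, orderOf w = d ∧ x * w = g} := by
  have hfix : ∀ w : G, orderOf w = d → w ^ t ^ K = w := fun w hw =>
    (pow_eq_self_iff_coprime hK hidem w).mpr (hw ▸ hdt)
  have hper : ∀ w ∈ {w | w ∈ C ∧ orderOf w = d}, minimalPeriod (powerMap G t) w = ordMod d t :=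
    fun w hw => by rw [minimalPeriod_powerMap, hw.2]
  have hord : ∀ w : G, orderOf w = d → ∀ n, orderOf (w ^ t ^ n) = d := by
    intro w hw n
    rw [Nat.Coprime.orderOf_pow (by rw [hw]; exact hdt.pow_right n), hw]
  have hcard := ncard_orderOf_eq C hd
  -- `orderOf` could be 0 by default. Here it is the period of an actual periodic element of order
  -- d.
  have hm : 0 < ordMod d t := by
    obtain ⟨w, hw⟩ : {w | w ∈ C ∧ orderOf w = d}.Nonempty := by
      rw [← Set.ncard_pos (Set.toFinite _), hcard]
      exact Nat.totient_pos.mpr (Nat.pos_of_dvd_of_pos hd Nat.card_pos)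
    rw [← hper w hw]
    refine minimalPeriod_pos_of_mem_periodicPts ⟨K, hK, ?_⟩
    rw [IsPeriodicPt, IsFixedPt, powerMap_iterate, hfix w hw.2]
  have hrep := exists_orbit_representatives (powerMap G t)
    {w | w ∈ C ∧ orderOf w = d} (Set.toFinite _)
    (fun w hw => ⟨C.pow_mem hw.1 t, by have := hord w hw.2 1; rwa [pow_one] at this⟩) hm hper
  rw [hcard] at hrep
  obtain ⟨r, hr, hcover, hdisj⟩ := hrep
  simp only [powerMap_iterate] at hcover hdisj
  have key := Realizes.copies (n := Nat.totient d / ordMod d t) (A := cyc (ordMod d t) T)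
    (f := powerMap G t) (X := fun i => {g | ∃ x ∈ U, ∃ n : ℕ, x * r i ^ t ^ n = g})
    (fun i => cyc_realizes hT hU (hfix _ (hr i).2) (fun x hx => hc x hx _ (hr i).1) hm
      (hper _ (hr i))) (cyc_total _ _) ?_
  · have hset : {g | ∃ x ∈ U, ∃ w ∈ C, orderOf w = d ∧ x * w = g} =
        ⋃ i, {g | ∃ x ∈ U, ∃ n : ℕ, x * r i ^ t ^ n = g} := by
      ext g
      simp only [Set.mem_iUnion, Set.mem_ofPred_eq]
      constructor
      · rintro ⟨x, hx, w, hw, hwd, rfl⟩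
        obtain ⟨i, n, rfl⟩ := hcover w ⟨hw, hwd⟩
        exact ⟨i, x, hx, n, rfl⟩
      · rintro ⟨i, x, hx, n, rfl⟩
        exact ⟨x, hx, _, C.pow_mem (hr i).1 _, hord _ (hr i).2 n, rfl⟩
    rw [hset]
    exact key
  · intro i j hij
    refine Set.disjoint_left.mpr ?_
    rintro _ ⟨x, hx, n, rfl⟩ ⟨y, hy, l, h⟩
    have h1 := fun z hz i n => (hc z hz _ (hr i).1).pow_right (t ^ n)
    have h2 := fun i n => hfix _ (hord _ (hr i).2 n)
    exact hij (hdisj i j n l (eq_of_mul_eq_mul_of_pow h.symm (h1 x hx i n) (h1 y hy j l) (hU x hx)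
      (hU y hy) (h2 i n) (h2 j l)))

end

/-! ### Coprime parts and cyclic subgroups -/

/-- A prime p dividing ν but not t would make p ω a larger divisor coprime to t. -/
theorem IsCoprimePart.exists_dvd_pow {t ν ω c : ℕ} (ht : 0 < t) (hc : 0 < c)
    (hω : IsCoprimePart t c ω) (h : c = ν * ω) : ∃ n, ν ∣ t ^ n := by
  have hpos : 0 < ν * ω := h ▸ hc
  refine (Nat.exists_dvd_pow_iff (Nat.pos_of_mul_pos_right hpos).ne' ht.ne').mpr fun p hp => ?_
  obtain ⟨hp, hpν, -⟩ := Nat.mem_primeFactors.mp hp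
  refine Nat.mem_primeFactors.mpr ⟨hp, ?_, ht.ne'⟩
  by_contra hpt
  have h1 : p * ω ≤ ω := hω.2 ⟨h ▸ Nat.mul_dvd_mul_right hpν ω,
    Nat.Coprime.mul_left ((Nat.Prime.coprime_iff_not_dvd hp).mpr hpt) hω.1.2⟩
  have h2 := Nat.pos_of_mul_pos_left hpos
  nlinarith [hp.two_le]

theorem IsCoprimePart.dvd {t ν ω c d : ℕ} (ht : 0 < t) (hc : 0 < c) (hω : IsCoprimePart t c ω)
    (h : c = ν * ω) (hd : d ∣ c) (hdt : Nat.Coprime d t) : d ∣ ω := by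
  obtain ⟨n, hn⟩ := hω.exists_dvd_pow ht hc h
  rw [h] at hd
  exact (Nat.Coprime.coprime_dvd_right hn (hdt.pow_right n)).dvd_of_dvd_mul_left hd

section
variable {G : Type u} [Group G]

theorem commute_of_mem_isCyclic (C : Subgroup G) [IsCyclic C] {x y : G} (hx : x ∈ C)
    (hy : y ∈ C) : Commute x y := by
  let : CommGroup C := IsCyclic.commGroup
  exact congrArg Subtype.val (mul_comm (⟨x, hx⟩ : C) ⟨y, hy⟩)

theorem ncard_pow_eq_one (C : Subgroup G) [Finite C] [IsCyclic C] (n : ℕ) :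
    {y | y ∈ C ∧ y ^ n = 1}.ncard = Nat.gcd (Nat.card C) n := by
  let : CommGroup C := IsCyclic.commGroup
  rw [← IsCyclic.card_powMonoidHom_ker C n, ← Nat.card_coe_set_eq]
  refine Nat.card_congr
    { toFun := fun y => ⟨⟨y.1, y.2.1⟩, Subtype.ext y.2.2⟩
      invFun := fun y => ⟨y.1.1, y.1.2, congrArg Subtype.val y.2⟩
      left_inv := fun _ => rfl
      right_inv := fun _ => rfl }

/-- The equation `y ^ Nat.card H = 1` has exactly |H| solutions in C, and H already supplies them
all. This later places periodic parts in the pistil. -/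
theorem mem_of_pow_card_eq_one {C H : Subgroup G} [Finite C] [IsCyclic C] (hH : H ≤ C) {x : G}
    (hx : x ∈ C) (h : x ^ Nat.card H = 1) : x ∈ H := by
  have hfin : {y | y ∈ C ∧ y ^ Nat.card H = 1}.Finite :=
    Set.Finite.subset (Set.toFinite (C : Set G)) fun y hy => hy.1
  have hsub : (H : Set G) ⊆ {y | y ∈ C ∧ y ^ Nat.card H = 1} := fun y hy =>
    ⟨hH hy, by
      have := pow_card_eq_one' (x := (⟨y, hy⟩ : H))
      exact congrArg Subtype.val this⟩
  have heq := Set.eq_of_subset_of_ncard_le hsub (by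
    rw [ncard_pow_eq_one, Nat.gcd_eq_right (Subgroup.card_dvd_of_le hH), ← Nat.card_coe_set_eq]
    rfl) hfin
  have : x ∈ (H : Set G) := heq ▸ ⟨hx, h⟩
  exact this

/-- Among divisors of ν ω, those dividing a power of t are exactly the divisors of ν. -/
theorem ncard_mem_backOrbit_one (C : Subgroup G) [Finite C] [IsCyclic C] {t ν ω : ℕ} (ht : 0 < t)
    (hω : IsCoprimePart t (Nat.card C) ω) (h : Nat.card C = ν * ω) :
    {y | y ∈ C ∧ y ∈ backOrbit (powerMap G t) 1}.ncard = ν := by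
  obtain ⟨n, hn⟩ := hω.exists_dvd_pow ht Nat.card_pos h
  have hgcd : Nat.gcd (Nat.card C) ν = ν := Nat.gcd_eq_right ⟨ω, h⟩
  rw [← hgcd, ← ncard_pow_eq_one]
  congr 1
  ext y
  refine and_congr_right fun hy => ?_
  rw [← orderOf_dvd_iff_pow_eq_one]
  constructor
  · rintro ⟨m, hm⟩
    rw [powerMap_iterate, ← orderOf_dvd_iff_pow_eq_one] at hm
    have hyC : orderOf y ∣ ν * ω := h ▸ C.orderOf_dvd_natCard hy
    refine Nat.Coprime.dvd_of_dvd_mul_right ?_ hyC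
    exact Nat.Coprime.coprime_dvd_left hm (hω.1.2.symm.pow_left m)
  · intro hy
    exact ⟨n, by rw [powerMap_iterate, ← orderOf_dvd_iff_pow_eq_one]; exact hy.trans hn⟩

/-! ### Petals -/

namespace IsFlower
variable {k : ℕ} {C₀ : Subgroup G} {C : Fin k → Subgroup G}

theorem isCyclic_petal (h : IsFlower C₀ C) (i : Fin k) : IsCyclic (C i) := ((h.petal_iff _).mpr ⟨i, rfl⟩).1

theorem exists_mem_petal (h : IsFlower C₀ C) (g : G) : ∃ i, g ∈ C i := by
  have := h.finite
  have hg : IsCyclic (Subgroup.zpowers g) := inferInstance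
  obtain ⟨M, hM, hmax⟩ := (Set.toFinite {H : Subgroup G | IsCyclic H}).exists_le_maximal hg
  obtain ⟨i, rfl⟩ := (h.petal_iff M).mp
    ⟨hmax.1, fun H hH hle => le_antisymm (hmax.2 hH hle) hle⟩
  exact ⟨i, hM (Subgroup.mem_zpowers g)⟩

/-- A lone petal would be all of G and make it cyclic. The second petal is what puts the pistil
inside each petal. -/
theorem exists_ne (h : IsFlower C₀ C) (i : Fin k) : ∃ j, j ≠ i := by
  by_contra! hall
  have := h.isCyclic_petal i
  refine h.not_cyclic (isCyclic_of_surjective (C i).subtype fun g => ?_)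
  obtain ⟨j, hj⟩ := h.exists_mem_petal g
  rw [hall j] at hj
  exact ⟨⟨g, hj⟩, rfl⟩

theorem pistil_le (h : IsFlower C₀ C) (i : Fin k) : C₀ ≤ C i := by
  obtain ⟨j, hj⟩ := h.exists_ne i
  rw [← h.inter j i hj]
  exact inf_le_right

theorem isCyclic_pistil (h : IsFlower C₀ C) : IsCyclic C₀ := by
  obtain ⟨i, -⟩ := h.exists_mem_petal 1
  have := h.isCyclic_petal i
  exact Subgroup.isCyclic_of_le (h.pistil_le i)

/-- Every element shares a petal, hence an abelian group, with the whole pistil. -/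
theorem commute_pistil (h : IsFlower C₀ C) (x : G) {w : G} (hw : w ∈ C₀) : Commute x w := by
  obtain ⟨i, hi⟩ := h.exists_mem_petal x
  have := h.isCyclic_petal i
  exact commute_of_mem_isCyclic (C i) hi (h.pistil_le i hw)

theorem eq_of_mem_of_mem (h : IsFlower C₀ C) {i j : Fin k} {x : G} (hi : x ∈ C i) (hj : x ∈ C j)
    (h0 : x ∉ C₀) : i = j := by
  by_contra hij
  exact h0 (h.inter i j hij ▸ ⟨hi, hj⟩)

/-- A subset of a flower group is counted by its traces on the petals and on the pistil. -/
theorem ncard_eq_sum (h : IsFlower C₀ C) (P : Set G) :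
    (P.ncard : ℤ) = (∑ i, ({y | y ∈ C i ∧ y ∈ P}.ncard : ℤ)) -
      ((k : ℤ) - 1) * ({y | y ∈ C₀ ∧ y ∈ P}.ncard : ℤ) := by
  have := h.finite
  have hsub : {y | y ∈ C₀ ∧ y ∈ P} ⊆ P := fun y hy => hy.2
  have hsubi : ∀ i, {y | y ∈ C₀ ∧ y ∈ P} ⊆ {y | y ∈ C i ∧ y ∈ P} :=
    fun i y hy => ⟨h.pistil_le i hy.1, hy.2⟩
  have hP := Set.ncard_sdiff_add_ncard_of_subset hsub
  have hPi := fun i => Set.ncard_sdiff_add_ncard_of_subset (hsubi i)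
  -- Off the pistil, each element lies in exactly one petal.
  have hsum : (P \ {y | y ∈ C₀ ∧ y ∈ P}).ncard =
      ∑ i, ({y | y ∈ C i ∧ y ∈ P} \ {y | y ∈ C₀ ∧ y ∈ P}).ncard := by
    simp only [← Nat.card_coe_set_eq]
    rw [← Nat.card_sigma]
    symm
    refine Nat.card_congr (Equiv.ofBijective
      (fun p => ⟨p.2.1, p.2.2.1.2, p.2.2.2⟩) ⟨?_, ?_⟩)
    · rintro ⟨i, x, hx⟩ ⟨j, y, hy⟩ hxy
      have hxy' : x = y := congrArg Subtype.val hxy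
      subst hxy'
      have hij : i = j := h.eq_of_mem_of_mem hx.1.1 hy.1.1 fun h0 => hx.2 ⟨h0, hx.1.2⟩
      subst hij
      rfl
    · rintro ⟨x, hx, hx0⟩
      obtain ⟨i, hi⟩ := h.exists_mem_petal x
      exact ⟨⟨i, x, ⟨hi, hx⟩, hx0⟩, rfl⟩
  have hsum' : (∑ i, ({y | y ∈ C i ∧ y ∈ P}.ncard : ℤ)) =
      (P \ {y | y ∈ C₀ ∧ y ∈ P}).ncard + (k : ℤ) * ({y | y ∈ C₀ ∧ y ∈ P}.ncard : ℤ) := by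
    rw [hsum, Finset.sum_congr rfl fun i _ => congrArg Nat.cast (hPi i).symm]
    push_cast
    rw [Finset.sum_add_distrib]
    simp
  rw [hsum', ← hP]
  push_cast
  ring

end IsFlower

end

end FlowerGroup

/-! ### Assembling the decomposition of a flower group -/

open FlowerGroup

theorem mainTheorem1 {G : Type*} [Group G] (t : ℕ) (ht : 0 < t) {k : ℕ}
    (c₀ : ℕ) (c : Fin k → ℕ) (hG : FlowerGroup.IsFlowerGroupOfType G c₀ c)
    (ν₀ ω₀ : ℕ) (hω₀ : FlowerGroup.IsCoprimePart t c₀ ω₀) (hc₀ : c₀ = ν₀ * ω₀)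
    (ν ω : Fin k → ℕ) (hω : ∀ i, FlowerGroup.IsCoprimePart t (c i) (ω i))
    (hc : ∀ i, c i = ν i * ω i) :
    FlowerGroup.Isomorphic
      (FlowerGroup.functionalGraph (FlowerGroup.powerMap G t))
      (FlowerGroup.disjUnion
        (FlowerGroup.disjUnionFamily fun i : Fin k =>
          FlowerGroup.disjUnionFamily fun d : {d : ℕ // d ∣ ω i ∧ ¬ d ∣ ω₀} =>
            FlowerGroup.cycleBlock t d.1 (FlowerGroup.gcdTree t (ν i)))
        (FlowerGroup.disjUnionFamily fun d : {d : ℕ // d ∣ ω₀} =>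
          FlowerGroup.cycleBlock t d.1 (FlowerGroup.centralTree t G))) ∧
    (Nat.card (FlowerGroup.centralTree t G).V : ℤ) =
      (∑ i, (ν i : ℤ)) - ((k : ℤ) - 1) * (ν₀ : ℤ) := by
  obtain ⟨C₀, C, hfl, rfl, hcard⟩ := hG
  obtain rfl : (fun i => Nat.card (C i)) = c := funext hcard
  have := hfl.finite
  have := hfl.isCyclic_pistil
  have := hfl.isCyclic_petal
  constructor
  · obtain ⟨K, hK, hidem⟩ := exists_pow_idempotent G t
    have hnil := mem_backOrbit_one_iff hK hidem
    have hfix := pow_eq_self_iff_coprime hK hidem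
    have hcop : ∀ i d, d ∣ ω i → Nat.Coprime d t := fun i d hd =>
      Nat.Coprime.coprime_dvd_left hd (hω i).1.2
    have hcop₀ : ∀ d, d ∣ ω₀ → Nat.Coprime d t := fun d hd =>
      Nat.Coprime.coprime_dvd_left hd hω₀.1.2
    have hpetal : ∀ i (d : {d : ℕ // d ∣ ω i ∧ ¬ d ∣ ω₀}),
        Realizes (cycleBlock t d.1 (gcdTree t (ν i))) (powerMap G t)
          {g | ∃ x ∈ {y | y ∈ C i ∧ y ∈ backOrbit (powerMap G t) 1}, ∃ w ∈ C i,
            orderOf w = d.1 ∧ x * w = g} := by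
      intro i d
      obtain ⟨n, hn⟩ := (hω i).exists_dvd_pow ht Nat.card_pos (hc i)
      exact cycleBlock_realizes hK hidem (gcdTree_realizes (C i) (hc i) (hω i).1.2 hn)
        (fun x hx => (hnil x).mp hx.2) (C i)
        (fun x hx w hw => commute_of_mem_isCyclic (C i) hx.1 hw)
        (d.2.1.trans (hω i).1.1) (hcop i d.1 d.2.1)
    have hcentre : ∀ d : {d : ℕ // d ∣ ω₀},
        Realizes (cycleBlock t d.1 (centralTree t G)) (powerMap G t)
          {g | ∃ x ∈ backOrbit (powerMap G t) 1, ∃ w ∈ C₀, orderOf w = d.1 ∧ x * w = g} :=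
      fun d => cycleBlock_realizes hK hidem (centralTree_realizes t) (fun x hx => (hnil x).mp hx)
        C₀ (fun x _ w hw => hfl.commute_pistil x hw) (d.2.trans hω₀.1.1) (hcop₀ d.1 d.2)
    have hnot : ∀ w : G, Nat.Coprime (orderOf w) t → ¬ orderOf w ∣ ω₀ → w ∉ C₀ :=
      fun w hw hd hwC => hd (hω₀.dvd ht Nat.card_pos hc₀ (C₀.orderOf_dvd_natCard hwC) hw)
    have heq : ∀ {x w x' w' : G}, x ∈ backOrbit (powerMap G t) 1 →
        x' ∈ backOrbit (powerMap G t) 1 → Nat.Coprime (orderOf w) t →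
        Nat.Coprime (orderOf w') t → Commute x w → Commute x' w' → x' * w' = x * w → w = w' :=
      fun hx hx' hw hw' hcm hcm' h => eq_of_mul_eq_mul_of_pow h.symm hcm hcm' ((hnil _).mp hx)
        ((hnil _).mp hx') ((hfix _).mpr hw) ((hfix _).mpr hw')
    have hall := Realizes.disjUnion
      (Realizes.disjUnionFamily (fun i => Realizes.disjUnionFamily (hpetal i) ?_) ?_)
      (Realizes.disjUnionFamily hcentre ?_) ?_
    · refine Realizes.isomorphic ?_
      convert hall
      symm
      refine Set.eq_univ_of_forall fun g => ?_
      obtain ⟨i, hi⟩ := hfl.exists_mem_petal g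
      have hwC : g ^ t ^ K ∈ C i := (C i).pow_mem hi _
      have hxC : g * (g ^ t ^ K)⁻¹ ∈ C i := (C i).mul_mem hi ((C i).inv_mem hwC)
      have hx : g * (g ^ t ^ K)⁻¹ ∈ backOrbit (powerMap G t) 1 := by
        rw [hnil, (((Commute.refl g).pow_right _).inv_right).mul_pow, inv_pow, hidem,
          mul_inv_cancel]
      have hw : Nat.Coprime (orderOf (g ^ t ^ K)) t := (hfix _).mp (hidem g)
      have hg : g * (g ^ t ^ K)⁻¹ * g ^ t ^ K = g := inv_mul_cancel_right _ _
      -- Divisibility by order decides the block: if it holds, the periodic part lies in the pistil;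
      -- otherwise it belongs to petal i alone.
      by_cases hd : orderOf (g ^ t ^ K) ∣ ω₀
      · refine Or.inr (Set.mem_iUnion.mpr ⟨⟨_, hd⟩, _, hx, _, ?_, rfl, hg⟩)
        exact mem_of_pow_card_eq_one (hfl.pistil_le i) hwC
          (orderOf_dvd_iff_pow_eq_one.mp (hd.trans hω₀.1.1))
      · have hdi := (hω i).dvd ht Nat.card_pos (hc i) ((C i).orderOf_dvd_natCard hwC) hw
        exact Or.inl (Set.mem_iUnion.mpr ⟨i, Set.mem_iUnion.mpr
          ⟨⟨_, hdi, hd⟩, _, ⟨hxC, hx⟩, _, hwC, rfl, hg⟩⟩)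
    · rintro d d' hne
      refine Set.disjoint_left.mpr ?_
      rintro _ ⟨x, hx, w, hw, hwd, rfl⟩ ⟨x', hx', w', hw', hwd', h⟩
      refine hne (Subtype.ext ?_)
      rw [← hwd, ← hwd', heq hx.2 hx'.2 (hwd ▸ hcop i _ d.2.1) (hwd' ▸ hcop i _ d'.2.1)
        (commute_of_mem_isCyclic _ hx.1 hw) (commute_of_mem_isCyclic _ hx'.1 hw') h]
    · rintro i j hne
      refine Set.disjoint_left.mpr ?_
      intro g hg hg'
      obtain ⟨d, x, hx, w, hw, hwd, rfl⟩ := Set.mem_iUnion.mp hg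
      obtain ⟨d', x', hx', w', hw', hwd', h⟩ := Set.mem_iUnion.mp hg'
      have hcw := hwd ▸ hcop i _ d.2.1
      have hww := heq hx.2 hx'.2 hcw (hwd' ▸ hcop j _ d'.2.1)
        (commute_of_mem_isCyclic _ hx.1 hw) (commute_of_mem_isCyclic _ hx'.1 hw') h
      rw [← hww] at hw'
      -- Two petal blocks that meet share their periodic part, which would have to lie in the
      -- pistil.
      exact hne (hfl.eq_of_mem_of_mem hw hw' (hnot w hcw (hwd ▸ d.2.2)))
    · rintro d d' hne
      refine Set.disjoint_left.mpr ?_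
      rintro _ ⟨x, hx, w, hw, hwd, rfl⟩ ⟨x', hx', w', hw', hwd', h⟩
      refine hne (Subtype.ext ?_)
      rw [← hwd, ← hwd', heq hx hx' (hwd ▸ hcop₀ _ d.2) (hwd' ▸ hcop₀ _ d'.2)
        (hfl.commute_pistil x hw) (hfl.commute_pistil x' hw') h]
    · refine Set.disjoint_left.mpr ?_
      intro g hg hg'
      obtain ⟨i, hg⟩ := Set.mem_iUnion.mp hg
      obtain ⟨d, x, hx, w, hw, hwd, rfl⟩ := Set.mem_iUnion.mp hg
      obtain ⟨d', x', hx', w', hw', hwd', h⟩ := Set.mem_iUnion.mp hg'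
      have hcw := hwd ▸ hcop i _ d.2.1
      have hww := heq hx.2 hx' hcw (hwd' ▸ hcop₀ _ d'.2)
        (commute_of_mem_isCyclic _ hx.1 hw) (hfl.commute_pistil x' hw') h
      rw [← hww] at hw'
      exact hnot w hcw (hwd ▸ d.2.2) hw'
  · have hV : Nat.card (centralTree t G).V = (backOrbit (powerMap G t) (1 : G)).ncard := by
      rw [← Nat.card_coe_set_eq]
      exact Nat.card_congr (Equiv.subtypeEquivRight inAttachedTree_one_iff)
    rw [hV, hfl.ncard_eq_sum, ncard_mem_backOrbit_one C₀ ht hω₀ hc₀]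
    simp only [ncard_mem_backOrbit_one (C _) ht (hω _) (hc _)]
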